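/- A Hadamard matrix of order $d$ is a $d\times d$ matrix $H$ with entries $\pm1$ and $H^TH=d\,\mathrm{Id}_d$. A polytope $P\subset\mathbb{R}^d$ is centrally symmetric (cs) if $P=-P$, and a cs polytope is $k$-neighborly if every set of $k$ of its vertices, no two of which are antipodes, is the vertex set of a face of $P$. Theorem. Let $d\ge 4$, let $H$ be any Hadamard matrix of order $d$, and set $k=\lfloor\frac12\sqrt d\rfloor$, $\alpha=\frac1{2k}$, $\beta=\frac{2k}{d}$ and $A=\alpha H$. Then the explicit polytope $$P=\operatorname{conv}\{\pm c : c \text{ a column of } (\mathrm{Id}_d\,|\,A)\}\subset\mathbb{R}^d$$ is a centrally symmetric $d$-dimensional polytope whose vertices are exactly the points $\pm c$; it has $4d$ vertices and is $\lfloor\frac12\sqrt d\rfloor$-neighborly. Moreover, the rows of the $2d\times d$ matrix $\binom{\mathrm{Id}_d}{-\beta H^T}$ form a cs-transform of its vertex set: they span $\mathbb{R}^d$, and the space of linear dependencies of the $2d$ columns of $(\mathrm{Id}_d\,|\,A)$, i.e. $\ker(\mathrm{Id}_d\,|\,A)$, is the column space of that matrix. In particular, a $\lfloor\frac12\sqrt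 d\rfloor$-neighborly cs $d$-polytope with $4d$ vertices exists for every $d\ge4$ for which a Hadamard matrix of order $d$ exists; such matrices exist for all $d=2^e$ with integers $e\ge2$. -/

import Mathlib

open scoped Pointwise

/-- A (convex) polytope: the convex hull of finitely many points. -/
def IsPolytope {d : ℕ} (P : Set (EuclideanSpace ℝ (Fin d))) : Prop :=
  ∃ V : Set (EuclideanSpace ℝ (Fin d)), V.Finite ∧ P = convexHull ℝ V

/-- The vertex set of a convex set (its extreme points). -/
def polytopeVertices {d : ℕ} (P : Set (EuclideanSpace ℝ (Fin d))) :
    Set (EuclideanSpace ℝ (Fin d)) :=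
  P.extremePoints ℝ

/-- The dimension of a polytope: the dimension of its affine hull. -/
noncomputable def polytopeDim {d : ℕ} (P : Set (EuclideanSpace ℝ (Fin d))) : ℕ :=
  Module.finrank ℝ (vectorSpan ℝ P)

/-- Every set of `k` vertices of `P`, no two of which are antipodes, is the vertex set of a
face of `P`; a face is the set of maximizers over `P` of some linear functional
(or the empty set). -/
def IsCsNeighborly {d : ℕ} (k : ℕ) (P : Set (EuclideanSpace ℝ (Fin d))) : Prop :=
  ∀ S : Finset (EuclideanSpace ℝ (Fin d)), (S : Set (EuclideanSpace ℝ (Fin d))) ⊆ polytopeVertices P →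
    S.card = k → (∀ x ∈ S, ∀ y ∈ S, x ≠ y → y ≠ -x) →
    ∃ F : Set (EuclideanSpace ℝ (Fin d)), IsExposed ℝ P F ∧
      polytopeVertices F = (S : Set (EuclideanSpace ℝ (Fin d)))

/-- `w` is a cs-transform of the centrally symmetric point set `{± v i}`: the vectors `w i` span
`ℝⁿ`, and the linear dependencies of the `v i` are exactly the coefficient vectors
`(⟨w i, u⟩)ᵢ` with `u ∈ ℝⁿ`. -/
def IsCsTransform {ι : Type*} [Fintype ι] {d n : ℕ} (v : ι → EuclideanSpace ℝ (Fin d))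
    (w : ι → EuclideanSpace ℝ (Fin n)) : Prop :=
  Submodule.span ℝ (Set.range w) = ⊤ ∧
    ∀ c : ι → ℝ, ∑ i, c i • v i = 0 ↔ ∃ u : EuclideanSpace ℝ (Fin n), ∀ i, c i = inner ℝ (w i) u

/-- The `2d` columns of the block matrix `(Id | A)`. -/
noncomputable def idColumns {d : ℕ} (A : Matrix (Fin d) (Fin d) ℝ) :
    Fin d ⊕ Fin d → EuclideanSpace ℝ (Fin d) :=
  fun s => WithLp.toLp 2 (fun i => Matrix.fromCols 1 A i s)

/-- The `2d` rows of the `2d × d` block matrix with `Id` on top of `B`. -/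
noncomputable def idRows {d : ℕ} (B : Matrix (Fin d) (Fin d) ℝ) :
    Fin d ⊕ Fin d → EuclideanSpace ℝ (Fin d) :=
  fun s => WithLp.toLp 2 (fun i => Matrix.fromRows 1 B s i)

/-- The centrally symmetric point set `{± v i}`. -/
def csPoints {ι : Type*} {d : ℕ} (v : ι → EuclideanSpace ℝ (Fin d)) :
    Set (EuclideanSpace ℝ (Fin d)) :=
  Set.range v ∪ -Set.range v

/-- The polytope `conv {± e₁, …, ± e_d, ± a₁, …, ± a_d}`, where `a₁, …, a_d` are the columns
of `A`. -/
noncomputable def csPolytope {d : ℕ} (A : Matrix (Fin d) (Fin d) ℝ) :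
    Set (EuclideanSpace ℝ (Fin d)) :=
  convexHull ℝ (csPoints (idColumns A))

/-!
Write `v` for the `2d` columns of `(Id | A)`. Everything about the faces of the polytope
`conv {± v x}` follows from one interpolation property: for every set `T` of at most `k` columns
and all signs `σ` on `T` there is a linear functional that takes the value `σ x` at `v x` for
`x ∈ T` and is smaller than `1` in absolute value at all other columns. With a one-element `T` it
shows that the points `± v x` are pairwise distinct and are vertices; with `T` of size `k` it
exposes the face spanned by a given antipode-free set of `k` vertices
(`isCsNeighborly_of_interpolates`).

To get the property, note that the vectors of values of linear functionals at the columns are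
exactly the `(y, α Hᵀ y)`. Since `α β d = 1`, they include the range of `1 + N`, where `N` is the
block matrix with off-diagonal blocks `β H` and `α Hᵀ`. Because `2k ≤ √d`, the entries of `N`
are at most `1 / (2k)` in absolute value, and its diagonal vanishes. So the `T × T` block of
`1 + N` is strictly diagonally dominant, hence invertible by Gershgorin's theorem, and a solution
`r` of the interpolation system supported on `T` has `‖r‖∞ < 2`; outside `T` the values are
then smaller than `k · (1 / (2k)) · 2 = 1` (`exists_interpolating_vector`).

The cs-transform is the statement that `(u, w)` with `u + α H w = 0` is determined by `u`, namely
`w = -β Hᵀ u`, because `α H` and `β Hᵀ` are inverse to each other.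
-/

/-! ### Solving a diagonally dominant interpolation problem -/

/-- If `N` has zero diagonal and entries bounded by `ε`, then for `T` with `2 |T| ε ≤ 1` the range
of `1 + N` contains a vector with prescribed entries in `[-1, 1]` on `T` and entries in `(-1, 1)`
off `T`. -/
theorem exists_interpolating_vector {ι : Type*} [Fintype ι] [DecidableEq ι] (N : Matrix ι ι ℝ)
    (ε : ℝ) (hε : 0 < ε) (hdiag : ∀ x, N x x = 0) (hN : ∀ x y, |N x y| ≤ ε)
    (T : Finset ι) (hT : 2 * (T.card * ε) ≤ 1) (σ : ι → ℝ) (hσ : ∀ x, |σ x| ≤ 1) :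
    ∃ r : ι → ℝ, (∀ x ∈ T, r x + N.mulVec r x = σ x) ∧
      ∀ x ∉ T, |r x + N.mulVec r x| < 1 := by
  classical
  let M : Matrix T T ℝ := 1 + N.submatrix Subtype.val Subtype.val
  have hMdet : M.det ≠ 0 := by
    apply det_ne_zero_of_sum_row_lt_diag
    intro x
    have hxx : M x x = 1 := by simp [M, hdiag]
    rw [hxx, norm_one]
    calc ∑ y ∈ Finset.univ.erase x, ‖M x y‖
        ≤ ∑ y ∈ (Finset.univ : Finset T).erase x, ε := by
          refine Finset.sum_le_sum fun y hy => ?_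
          have hxy : x ≠ y := (Finset.ne_of_mem_erase hy).symm
          simpa [M, Matrix.one_apply_ne hxy] using hN x y
      _ ≤ ∑ y : T, ε := Finset.sum_le_sum_of_subset_of_nonneg (Finset.erase_subset _ _)
          fun _ _ _ => hε.le
      _ = T.card * ε := by simp
      _ < 1 := by linarith
  have hunit : IsUnit M := (Matrix.isUnit_iff_isUnit_det M).2 (isUnit_iff_ne_zero.2 hMdet)
  obtain ⟨r₀, hr₀⟩ := (Matrix.mulVec_surjective_iff_isUnit.2 hunit) (fun x : T => σ x)
  let r : ι → ℝ := fun x => if h : x ∈ T then r₀ ⟨x, h⟩ else 0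
  have hr_off : ∀ x ∉ T, r x = 0 := fun x hx => by simp [r, hx]
  have hr_on : ∀ x : T, r x = r₀ x := fun x => by simp [r]
  have hmul : ∀ x, N.mulVec r x = ∑ y ∈ T, N x y * r y := fun x => by
    rw [Matrix.mulVec, dotProduct]
    exact (Finset.sum_subset (Finset.subset_univ T) fun y _ hy => by rw [hr_off y hy, mul_zero]).symm
  have hsol : ∀ x ∈ T, r x + N.mulVec r x = σ x := by
    intro x hx
    have h := congrFun hr₀ ⟨x, hx⟩
    rw [Matrix.add_mulVec, Matrix.one_mulVec, Pi.add_apply, Matrix.mulVec, dotProduct] at h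
    rw [hmul, ← h, ← Finset.sum_coe_sort, ← hr_on ⟨x, hx⟩]
    simp [hr_on]
  refine ⟨r, hsol, fun x hx => ?_⟩
  rw [hr_off x hx, zero_add, hmul]
  rcases T.eq_empty_or_nonempty with rfl | hne
  · simp
  obtain ⟨x₀, hx₀, hmax⟩ := T.exists_max_image (fun x => |r x|) hne
  have hm : 0 ≤ |r x₀| := abs_nonneg _
  have hterm : ∀ z, ∀ y ∈ T, |N z y * r y| ≤ ε * |r x₀| := fun z y hy => by
    rw [abs_mul]
    exact mul_le_mul (hN z y) (hmax y hy) (abs_nonneg _) hε.le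
  have hoff : |∑ y ∈ T, N x y * r y| ≤ T.card * ε * |r x₀| :=
    (Finset.abs_sum_le_sum_abs _ _).trans <|
      (Finset.sum_le_sum (hterm x)).trans (by simp [mul_assoc])
  -- The zero diagonal saves one summand, which makes the bound `|r x₀| < 2` strict.
  have hon : |∑ y ∈ T, N x₀ y * r y| ≤ T.card * ε * |r x₀| - ε * |r x₀| := by
    rw [← Finset.add_sum_erase T _ hx₀, hdiag, zero_mul, zero_add]
    refine (Finset.abs_sum_le_sum_abs _ _).trans <|
      (Finset.sum_le_sum fun y hy => hterm x₀ y (Finset.mem_of_mem_erase hy)).trans ?_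
    have hcard : (((T.erase x₀).card : ℕ) : ℝ) + 1 = T.card := by
      exact_mod_cast Finset.card_erase_add_one hx₀
    rw [Finset.sum_const, nsmul_eq_mul, ← hcard]
    exact le_of_eq (by ring)
  have hr : |r x₀| ≤ 1 + (T.card * ε * |r x₀| - ε * |r x₀|) := by
    have h := hsol x₀ hx₀
    rw [hmul] at h
    rw [show r x₀ = σ x₀ - ∑ y ∈ T, N x₀ y * r y by linarith]
    refine (abs_sub _ _).trans (add_le_add (hσ x₀) ?_)
    rwa [← show r x₀ = σ x₀ - ∑ y ∈ T, N x₀ y * r y by linarith]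
  have hhalf : T.card * ε * |r x₀| ≤ |r x₀| / 2 := by nlinarith
  rcases hm.eq_or_lt with h0 | hpos
  · rw [← h0, mul_zero] at hoff
    linarith
  · have := mul_pos hε hpos
    linarith

/-! ### Centrally symmetric polytopes with the interpolation property -/

/-- Arbitrary signs on at most `k` of the points `v x` are the values of a linear functional
(given as an inner product) that is smaller than `1` in absolute value at all other points. -/
def Interpolates {ι : Type*} {d : ℕ} (k : ℕ) (v : ι → EuclideanSpace ℝ (Fin d)) : Prop :=
  ∀ (T : Finset ι) (σ : ι → ℝ), T.card ≤ k → (∀ x, |σ x| ≤ 1) →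
    ∃ y : EuclideanSpace ℝ (Fin d),
      (∀ x ∈ T, inner ℝ y (v x) = σ x) ∧ ∀ x ∉ T, |inner ℝ y (v x)| < 1

section Interpolates

variable {ι : Type*} {d k : ℕ} {v : ι → EuclideanSpace ℝ (Fin d)}

theorem Interpolates.exists_peak (h : Interpolates k v) (hk : 1 ≤ k) (x : ι) :
    ∃ y : EuclideanSpace ℝ (Fin d), inner ℝ y (v x) = (1 : ℝ) ∧
      ∀ z, z ≠ x → |(inner ℝ y (v z) : ℝ)| < 1 := by
  obtain ⟨y, h1, h2⟩ := h {x} (fun _ => 1) (by simpa using hk) (by simp)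
  exact ⟨y, h1 x (by simp), fun z hz => h2 z (by simpa using hz)⟩

theorem Interpolates.injective (h : Interpolates k v) (hk : 1 ≤ k) : Function.Injective v := by
  intro x z hxz
  obtain ⟨y, h1, h2⟩ := h.exists_peak hk x
  by_contra hne
  have := h2 z (Ne.symm hne)
  rw [← hxz, h1] at this
  simp at this

theorem Interpolates.ne_neg (h : Interpolates k v) (hk : 1 ≤ k) (x z : ι) : v x ≠ -v z := by
  intro hxz
  obtain ⟨y, h1, h2⟩ := h.exists_peak hk x
  rcases eq_or_ne z x with rfl | hne
  · have h3 := congrArg (fun w => (inner ℝ y w : ℝ)) hxz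
    simp only [inner_neg_right, h1] at h3
    linarith
  · have := h2 z hne
    rw [← neg_eq_iff_eq_neg.2 hxz, inner_neg_right, h1] at this
    simp at this

theorem mem_csPoints {p : EuclideanSpace ℝ (Fin d)} :
    p ∈ csPoints v ↔ ∃ x, p = v x ∨ p = -v x := by
  simp only [csPoints, Set.mem_union, Set.mem_range, Set.mem_neg, exists_or]
  refine or_congr (exists_congr fun x => eq_comm) (exists_congr fun x => ?_)
  rw [eq_comm, neg_eq_iff_eq_neg]

theorem csPoints_finite [Finite ι] : (csPoints v).Finite :=
  (Set.finite_range v).union (Set.finite_range v).neg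

theorem neg_csPoints : -csPoints v = csPoints v := by
  rw [csPoints, Set.union_neg, neg_neg, Set.union_comm]

theorem Interpolates.ncard_csPoints [Fintype ι] (h : Interpolates k v) (hk : 1 ≤ k) :
    (csPoints v).ncard = 2 * Fintype.card ι := by
  have hdisj : Disjoint (Set.range v) (-Set.range v) := by
    rw [Set.disjoint_left]
    rintro _ ⟨x, rfl⟩ ⟨z, hz⟩
    exact h.ne_neg hk z x hz
  have hr : (Set.range v).ncard = Fintype.card ι := by
    rw [← Set.image_univ, Set.ncard_image_of_injective _ (h.injective hk), Set.ncard_univ,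
      Nat.card_eq_fintype_card]
  have hn : (-Set.range v).ncard = Fintype.card ι := by
    rw [← Set.image_neg_eq_neg, Set.ncard_image_of_injective _ neg_injective, hr]
  rw [csPoints, Set.ncard_union_eq hdisj (Set.finite_range v) (Set.finite_range v).neg, hr, hn]
  ring

/-- A functional bounded by `1` on the points `v x` is bounded by `1` on the symmetric polytope. -/
theorem inner_le_one_of_mem_convexHull_csPoints {y p : EuclideanSpace ℝ (Fin d)}
    (hy : ∀ x, |(inner ℝ y (v x) : ℝ)| ≤ 1) (hp : p ∈ convexHull ℝ (csPoints v)) :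
    (inner ℝ y p : ℝ) ≤ 1 := by
  have hsub : convexHull ℝ (csPoints v) ⊆ {w | innerSL ℝ y w ≤ 1} := by
    refine convexHull_min (fun w hw => ?_) (convex_halfSpace_le (innerSL ℝ y).isLinear 1)
    obtain ⟨x, rfl | rfl⟩ := mem_csPoints.1 hw
    · exact (abs_le.1 (hy x)).2
    · change (inner ℝ y (-v x) : ℝ) ≤ 1
      rw [inner_neg_right]
      linarith [(abs_le.1 (hy x)).1]
  exact hsub hp

/-- The face of the symmetric polytope on which a functional bounded by `1` on the points `v x`
takes the value `1`, provided it is attained. -/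
theorem isExposed_inner_eq_one {y q : EuclideanSpace ℝ (Fin d)}
    (hy : ∀ x, |(inner ℝ y (v x) : ℝ)| ≤ 1) (hq : q ∈ csPoints v) (hq1 : inner ℝ y q = (1 : ℝ)) :
    IsExposed ℝ (convexHull ℝ (csPoints v))
      {p ∈ convexHull ℝ (csPoints v) | inner ℝ y p = (1 : ℝ)} := by
  refine fun _ => ⟨innerSL ℝ y, ?_⟩
  ext p
  refine and_congr_right fun hp => ⟨fun h1 w hw => ?_, fun hmax => ?_⟩
  · change (inner ℝ y w : ℝ) ≤ inner ℝ y p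
    rw [h1]
    exact inner_le_one_of_mem_convexHull_csPoints hy hw
  · refine le_antisymm (inner_le_one_of_mem_convexHull_csPoints hy hp) ?_
    rw [← hq1]
    exact hmax q (subset_convexHull ℝ _ hq)

/-- A functional bounded by `1` on the points `v x` that equals `1`, among the points `± v x`,
exactly at those in the antipode-free set `S`: interpolate the signs with which the `v x` occur in `S`. -/
theorem Interpolates.exists_inner_eq_one_iff [Fintype ι] (h : Interpolates k v) (hk : 1 ≤ k)
    {S : Finset (EuclideanSpace ℝ (Fin d))} (hcard : S.card ≤ k) (hanti : ∀ x ∈ S, ∀ y ∈ S, x ≠ y → y ≠ -x) :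
    ∃ y : EuclideanSpace ℝ (Fin d), (∀ x, |(inner ℝ y (v x) : ℝ)| ≤ 1) ∧
      ∀ p ∈ csPoints v, inner ℝ y p = (1 : ℝ) ↔ p ∈ S := by
  classical
  let T : Finset ι := Finset.univ.filter fun x => v x ∈ S ∨ -v x ∈ S
  let f : ι → EuclideanSpace ℝ (Fin d) := fun x => if v x ∈ S then v x else -v x
  have hTcard : T.card ≤ k := by
    refine le_trans (Finset.card_le_card_of_injOn f (fun x hx => ?_) (fun x _ z _ hxz => ?_)) hcard
    · have hx' : v x ∈ S ∨ -v x ∈ S := by simpa [T] using hx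
      by_cases hv : v x ∈ S
      · simp [f, hv]
      · simpa [f, hv] using hx'
    · simp only [f] at hxz
      split_ifs at hxz
      · exact h.injective hk hxz
      · exact absurd hxz (h.ne_neg hk x z)
      · exact absurd hxz.symm (h.ne_neg hk z x)
      · exact h.injective hk (neg_injective hxz)
  obtain ⟨y, hyT, hyoff⟩ := h T (fun x => if v x ∈ S then 1 else -1) hTcard
    (fun x => by split_ifs <;> simp)
  refine ⟨y, fun x => ?_, fun p hp => ⟨fun hp1 => ?_, fun hpS => ?_⟩⟩
  · by_cases hx : x ∈ T
    · rw [hyT x hx]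
      split_ifs <;> simp
    · exact (hyoff x hx).le
  · obtain ⟨x, hx⟩ := mem_csPoints.1 hp
    have hxT : x ∈ T := by
      by_contra hxT
      have := abs_lt.1 (hyoff x hxT)
      rcases hx with rfl | rfl
      · linarith
      · rw [inner_neg_right] at hp1
        linarith
    have hval := hyT x hxT
    have hxS : v x ∈ S ∨ -v x ∈ S := by simpa [T] using hxT
    rcases hx with rfl | rfl
    · by_contra hv
      rw [if_neg hv] at hval
      linarith
    · refine hxS.resolve_left fun hv => ?_
      rw [if_pos hv] at hval
      rw [inner_neg_right] at hp1
      linarith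
  · obtain ⟨x, rfl | rfl⟩ := mem_csPoints.1 hp
    · rw [hyT x (by simp [T, hpS]), if_pos hpS]
    · have hx : v x ∉ S := fun hx => hanti _ hx _ hpS (h.ne_neg hk x x) rfl
      rw [inner_neg_right, hyT x (by simp [T, hpS]), if_neg hx, neg_neg]

theorem Interpolates.extremePoints_eq [Fintype ι] (h : Interpolates k v) (hk : 1 ≤ k) :
    (convexHull ℝ (csPoints v)).extremePoints ℝ = csPoints v := by
  refine Set.Subset.antisymm extremePoints_convexHull_subset fun p hp => ?_
  obtain ⟨y, hy, hyp⟩ := h.exists_inner_eq_one_iff hk (S := {p}) (by simpa using hk)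
    (fun x hx z hz hxz =>
      absurd ((Finset.mem_singleton.1 hx).trans (Finset.mem_singleton.1 hz).symm) hxz)
  have hp1 : inner ℝ y p = (1 : ℝ) := (hyp p hp).2 (Finset.mem_singleton_self p)
  have hexp := isExposed_inner_eq_one hy hp hp1
  -- By Krein–Milman the exposed face has an extreme point, which can only be `p`.
  obtain ⟨q, hq⟩ := (hexp.isCompact (csPoints_finite.isCompact_convexHull ℝ)).extremePoints_nonempty
    ⟨p, subset_convexHull ℝ _ hp, hp1⟩
  rw [hexp.isExtreme.extremePoints_eq] at hq
  have hqp : q = p :=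
    Finset.mem_singleton.1 ((hyp q (extremePoints_convexHull_subset hq.2)).1 hq.1.2)
  exact hqp ▸ hq.2

/-- Interpolation for `k` points makes the symmetric polytope `k`-neighborly. -/
theorem isCsNeighborly_of_interpolates [Fintype ι] (h : Interpolates k v) (hk : 1 ≤ k) :
    IsCsNeighborly k (convexHull ℝ (csPoints v)) := by
  intro S hS hcard hanti
  have hvert := h.extremePoints_eq hk
  rw [polytopeVertices, hvert] at hS
  obtain ⟨y, hy, hyS⟩ := h.exists_inner_eq_one_iff hk hcard.le hanti
  obtain ⟨q, hq⟩ : S.Nonempty := Finset.card_pos.1 (by omega)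
  have hexp := isExposed_inner_eq_one hy (hS hq) ((hyS q (hS hq)).2 hq)
  refine ⟨_, hexp, ?_⟩
  rw [polytopeVertices, hexp.isExtreme.extremePoints_eq, hvert]
  ext p
  exact ⟨fun hp => (hyS p hp.2).1 hp.1.2,
    fun hp => ⟨⟨subset_convexHull ℝ _ (hS hp), (hyS p (hS hp)).2 hp⟩, hS hp⟩⟩

end Interpolates

/-! ### The columns of `(Id | α H)` -/

section Columns

variable {d : ℕ}

@[simp]
theorem idColumns_inl (A : Matrix (Fin d) (Fin d) ℝ) (i : Fin d) :
    idColumns A (Sum.inl i) = EuclideanSpace.single i (1 : ℝ) := by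
  ext j
  simp [idColumns, Matrix.one_apply]

theorem inner_idColumns_inl (A : Matrix (Fin d) (Fin d) ℝ) (y : EuclideanSpace ℝ (Fin d))
    (i : Fin d) : (inner ℝ y (idColumns A (Sum.inl i)) : ℝ) = y i := by
  simp [EuclideanSpace.inner_single_right]

theorem inner_idColumns_inr (A : Matrix (Fin d) (Fin d) ℝ) (y : EuclideanSpace ℝ (Fin d))
    (j : Fin d) : (inner ℝ y (idColumns A (Sum.inr j)) : ℝ) = A.transpose.mulVec y j := by
  simp [idColumns, PiLp.inner_apply, Matrix.mulVec, dotProduct]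

@[simp]
theorem idRows_inl (B : Matrix (Fin d) (Fin d) ℝ) (i : Fin d) :
    idRows B (Sum.inl i) = EuclideanSpace.single i (1 : ℝ) := by
  ext j
  simp [idRows, Matrix.one_apply, eq_comm]

theorem inner_idRows_inl (B : Matrix (Fin d) (Fin d) ℝ) (u : EuclideanSpace ℝ (Fin d))
    (i : Fin d) : (inner ℝ (idRows B (Sum.inl i)) u : ℝ) = u i := by
  simp [EuclideanSpace.inner_single_left]

theorem inner_idRows_inr (B : Matrix (Fin d) (Fin d) ℝ) (u : EuclideanSpace ℝ (Fin d))
    (j : Fin d) : (inner ℝ (idRows B (Sum.inr j)) u : ℝ) = B.mulVec u j := by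
  simp [idRows, PiLp.inner_apply, Matrix.mulVec, dotProduct, mul_comm]

theorem sum_smul_idColumns_eq_zero_iff (A : Matrix (Fin d) (Fin d) ℝ) (c : Fin d ⊕ Fin d → ℝ) :
    ∑ s, c s • idColumns A s = 0 ↔ (c ∘ Sum.inl) + A.mulVec (c ∘ Sum.inr) = 0 := by
  have hcomp : ∀ i, (∑ s, c s • idColumns A s) i = ((c ∘ Sum.inl) + A.mulVec (c ∘ Sum.inr)) i := by
    intro i
    simp [idColumns, Matrix.mulVec, dotProduct, Matrix.one_apply, mul_comm]
  constructor
  · intro h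
    ext i
    rw [← hcomp i, h]
    rfl
  · intro h
    ext i
    rw [hcomp i, h]
    rfl

theorem span_range_single :
    Submodule.span ℝ (Set.range fun i : Fin d => EuclideanSpace.single i (1 : ℝ)) = ⊤ := by
  simpa [← EuclideanSpace.basisFun_apply] using
    (EuclideanSpace.basisFun (Fin d) ℝ).toBasis.span_eq

theorem polytopeDim_csPolytope (A : Matrix (Fin d) (Fin d) ℝ) : polytopeDim (csPolytope A) = d := by
  have htop : vectorSpan ℝ (csPolytope A) = ⊤ := by
    rw [eq_top_iff, ← span_range_single, Submodule.span_le]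
    rintro _ ⟨i, rfl⟩
    have hmem : ∀ p ∈ csPoints (idColumns A), p ∈ csPolytope A := fun p hp =>
      subset_convexHull ℝ _ hp
    have h := vsub_mem_vectorSpan ℝ (hmem _ (mem_csPoints.2 ⟨Sum.inl i, Or.inl rfl⟩))
      (hmem _ (mem_csPoints.2 ⟨Sum.inl i, Or.inr rfl⟩))
    have h2 := Submodule.smul_mem _ (1 / 2 : ℝ) h
    rw [vsub_eq_sub, sub_neg_eq_add, ← two_smul ℝ, smul_smul, idColumns_inl] at h2
    simpa using h2
  rw [polytopeDim, htop, finrank_top, finrank_euclideanSpace_fin]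

theorem Matrix.IsHadamard.abs_apply {H : Matrix (Fin d) (Fin d) ℝ} (hH : H.IsHadamard)
    (i j : Fin d) : |H i j| = 1 := by
  have h := Unitary.star_mul_self_of_mem (hH.apply_mem i j)
  rw [star_trivial, ← abs_mul_abs_self] at h
  nlinarith [abs_nonneg (H i j)]

theorem Matrix.IsHadamard.transpose_mulVec_mulVec {H : Matrix (Fin d) (Fin d) ℝ}
    (hH : H.IsHadamard) (q : Fin d → ℝ) : H.transpose.mulVec (H.mulVec q) = (d : ℝ) • q := by
  have h := hH.conjTranspose_mul
  rw [Matrix.conjTranspose_eq_transpose_of_trivial] at h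
  rw [Matrix.mulVec_mulVec, h, Matrix.smul_mulVec, Matrix.one_mulVec, Fintype.card_fin]

theorem interpolates_idColumns {H : Matrix (Fin d) (Fin d) ℝ} (hH : H.IsHadamard) {k : ℕ}
    {α β : ℝ} (hk : 1 ≤ k) (hα : α = 1 / (2 * (k : ℝ))) (hβ0 : 0 ≤ β) (hβ : β ≤ α)
    (hαβ : α * β * d = 1) : Interpolates k (idColumns (α • H)) := by
  intro T σ hT hσ
  have hk0 : (0 : ℝ) < k := by exact_mod_cast hk
  have hα0 : 0 < α := by rw [hα]; positivity
  obtain ⟨r, hr, hr'⟩ := exists_interpolating_vector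
    (Matrix.fromBlocks 0 (β • H) (α • H.transpose) 0) α hα0
    (by rintro (i | i) <;> simp)
    (by
      rintro (i | i) (j | j)
      · simpa using hα0.le
      · simpa [abs_mul, hH.abs_apply, abs_of_nonneg hβ0] using hβ
      · simp [abs_mul, hH.abs_apply, abs_of_pos hα0]
      · simpa using hα0.le)
    T
    (by
      have h1 : (T.card : ℝ) ≤ k := by exact_mod_cast hT
      have h2 : 2 * (k * α) = 1 := by rw [hα]; field_simp
      nlinarith)
    σ hσ
  set p : Fin d → ℝ := r ∘ Sum.inl
  set q : Fin d → ℝ := r ∘ Sum.inr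
  have hval : ∀ s, (inner ℝ (WithLp.toLp 2 (p + β • H.mulVec q)) (idColumns (α • H) s) : ℝ) =
      r s + (Matrix.fromBlocks 0 (β • H) (α • H.transpose) 0).mulVec r s := by
    rintro (i | j)
    · rw [inner_idColumns_inl, Matrix.fromBlocks_mulVec]
      simp [p, q, Matrix.smul_mulVec]
    · rw [inner_idColumns_inr, Matrix.fromBlocks_mulVec]
      have : (α • H).transpose.mulVec (p + β • H.mulVec q) =
          α • H.transpose.mulVec p + q := by
        rw [Matrix.mulVec_add, Matrix.transpose_smul, Matrix.mulVec_smul, Matrix.smul_mulVec,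
          Matrix.smul_mulVec, hH.transpose_mulVec_mulVec, smul_smul, smul_smul,
          show β * α * d = 1 by linarith, one_smul]
      simp only [this]
      simp [p, q, Matrix.smul_mulVec, add_comm]
  exact ⟨_, fun x hx => (hval x).trans (hr x hx), fun x hx => by rw [hval x]; exact hr' x hx⟩

theorem isCsTransform_idRows {H : Matrix (Fin d) (Fin d) ℝ} (hH : H.IsHadamard) {α β : ℝ}
    (hαβ : α * β * d = 1) :
    IsCsTransform (idColumns (α • H)) (idRows (-(β • H.transpose))) := by
  constructor
  · rw [eq_top_iff, ← span_range_single]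
    refine Submodule.span_mono ?_
    rintro _ ⟨i, rfl⟩
    exact ⟨Sum.inl i, idRows_inl _ i⟩
  · intro c
    rw [sum_smul_idColumns_eq_zero_iff]
    constructor
    · intro hc
      have hinl : c ∘ Sum.inl = -(α • H.mulVec (c ∘ Sum.inr)) := by
        rw [← Matrix.smul_mulVec]
        exact eq_neg_of_add_eq_zero_left hc
      refine ⟨WithLp.toLp 2 (c ∘ Sum.inl), ?_⟩
      rintro (i | j)
      · rw [inner_idRows_inl]
        rfl
      · rw [inner_idRows_inr]
        have : (-(β • H.transpose)).mulVec (c ∘ Sum.inl) = c ∘ Sum.inr := by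
          rw [hinl, Matrix.neg_mulVec, Matrix.mulVec_neg, neg_neg, Matrix.smul_mulVec,
            Matrix.mulVec_smul, hH.transpose_mulVec_mulVec, smul_smul, smul_smul,
            show β * α * d = 1 by linarith, one_smul]
        exact (congrFun this j).symm
    · rintro ⟨u, hu⟩
      have hinl : c ∘ Sum.inl = u := by
        ext i
        exact (hu (Sum.inl i)).trans (inner_idRows_inl _ u i)
      have hinr : c ∘ Sum.inr = (-(β • H.transpose)).mulVec u := by
        ext j
        exact (hu (Sum.inr j)).trans (inner_idRows_inr _ u j)
      have h := hH.transpose.transpose_mulVec_mulVec (u : Fin d → ℝ)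
      rw [Matrix.transpose_transpose] at h
      rw [hinl, hinr, Matrix.neg_mulVec, Matrix.mulVec_neg, Matrix.smul_mulVec, Matrix.smul_mulVec,
        Matrix.mulVec_smul, h, smul_smul, smul_smul, hαβ, one_smul,
        add_neg_cancel]

end Columns

/-! ### Hadamard matrices of order `2 ^ e` -/

/-- Sylvester's construction: iterated Kronecker products of the Hadamard matrix of order two. -/
theorem exists_isHadamard_two_pow (e : ℕ) :
    ∃ H : Matrix (Fin (2 ^ e)) (Fin (2 ^ e)) ℝ, H.IsHadamard := by
  induction e with
  | zero =>
    refine ⟨1, fun i j => ?_, by simp, by simp⟩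
    rw [show i = j by omega, Matrix.one_apply_eq]
    exact one_mem _
  | succ e ih =>
    obtain ⟨H, hH⟩ := ih
    have h2 : (!![1, 1; 1, -1] : Matrix (Fin 2) (Fin 2) ℝ).IsHadamard := by
      refine ⟨fun i j => ?_, ?_, ?_⟩
      · rw [Unitary.mem_iff]
        fin_cases i <;> fin_cases j <;> simp
      all_goals
        ext i j
        fin_cases i <;> fin_cases j <;>
          norm_num [Matrix.mul_apply, Fin.sum_univ_two, Matrix.one_apply]
    exact ⟨_, (hH.kronecker h2).reindex finProdFinEquiv (finProdFinEquiv.trans (finCongr rfl))⟩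

theorem theorem1 :
    (∀ (d : ℕ), 4 ≤ d → ∀ H : Matrix (Fin d) (Fin d) ℝ, H.IsHadamard →
      ∀ (k : ℕ) (α β : ℝ), k = ⌊Real.sqrt (d : ℝ) / 2⌋₊ →
        α = 1 / (2 * (k : ℝ)) → β = 2 * (k : ℝ) / (d : ℝ) →
        IsPolytope (csPolytope (α • H)) ∧
        csPolytope (α • H) = -csPolytope (α • H) ∧
        polytopeDim (csPolytope (α • H)) = d ∧
        polytopeVertices (csPolytope (α • H)) = csPoints (idColumns (α • H)) ∧
        (polytopeVertices (csPolytope (α • H))).ncard = 4 * d ∧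
        IsCsTransform (idColumns (α • H)) (idRows (-(β • H.transpose))) ∧
        IsCsNeighborly k (csPolytope (α • H))) ∧
    (∀ e : ℕ, 2 ≤ e → ∃ H : Matrix (Fin (2 ^ e)) (Fin (2 ^ e)) ℝ, H.IsHadamard) := by
  refine ⟨?_, fun e _ => exists_isHadamard_two_pow e⟩
  intro d hd H hH k α β hk hα hβ
  have hd4 : (4 : ℝ) ≤ d := by exact_mod_cast hd
  have hsqrt : Real.sqrt d ^ 2 = d := Real.sq_sqrt (by linarith)
  have hk1 : 1 ≤ k := by
    rw [hk, Nat.one_le_floor_iff]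
    nlinarith [Real.sqrt_nonneg (d : ℝ)]
  have hkd : (k : ℝ) ≤ Real.sqrt d / 2 := by
    rw [hk]
    exact Nat.floor_le (by positivity)
  have hk0 : (0 : ℝ) < k := by exact_mod_cast hk1
  have hβα : β ≤ α := by
    rw [hα, hβ, div_le_div_iff₀ (by linarith) (by linarith)]
    nlinarith
  have hαβ : α * β * d = 1 := by
    rw [hα, hβ]
    field_simp
  have hint := interpolates_idColumns hH hk1 hα (by rw [hβ]; positivity) hβα hαβ
  have hvert : polytopeVertices (csPolytope (α • H)) = csPoints (idColumns (α • H)) :=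
    hint.extremePoints_eq hk1
  refine ⟨⟨_, csPoints_finite, rfl⟩, ?_, polytopeDim_csPolytope _, hvert, ?_,
    isCsTransform_idRows hH hαβ, isCsNeighborly_of_interpolates hint hk1⟩
  · rw [csPolytope, ← convexHull_neg, neg_csPoints]
  · rw [hvert, hint.ncard_csPoints hk1, Fintype.card_sum, Fintype.card_fin]
    ring
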